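/- Let $n\ge 1$. For a prime $p$ and $A=(\overline{a_{ij}})\in \mathrm{GL}_n(\mathbb F_p)$ with inverse $A^{-1}=(\overline{b_{ij}})$, where $a_{ij},b_{ij}\in\{0,1,\dots,p-1\}$ are the representatives of the entries, let $$g_p(A)=\Big(\frac{a_{i1}}p,\dots,\frac{a_{in}}p,\frac{b_{i1}}p,\dots,\frac{b_{in}}p\Big)_{1\le i\le n}\in[0,1]^{2n^2}.$$ A rectangle is a product of bounded intervals of $\mathbb R$ (each open, closed or half-open), rectangles are non-overlapping if their interiors are pairwise disjoint, and "area" is $2n^2$-dimensional Lebesgue measure. Let $R\subset[0,1]^{2n^2}$ be a measurable set such that for every $\epsilon>0$ there are two finite collections of non-overlapping rectangles $R_1,\dots,R_k$ and $R^1,\dots,R^l$ with $$\bigcup_{i=1}^k R_i\subset R\subset\bigcup_{j=1}^l R^j,\qquad \mathrm{area}\Big(R\setminus\bigcup_{i=1}^k R_i\Big)<\epsilon,\qquad \mathrm{area}\Big(\bigcup_{j=1}^l R^j\setminus R\Big)<\epsilon .$$ Then, as $p$ runs through the primes, $$\lim_{p\to\infty}\frac{\#\big(g_p(\mathrm{GL}_n(\mathbb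 F_p))\cap R\big)}{\#\mathrm{GL}_n(\mathbb F_p)}=\mathrm{area}(R).$$ -/

import Mathlib

open Filter Topology MeasureTheory Matrix

/-- A box (rectangle) with sides parallel to the axes: a product of bounded intervals of the real
line. Each interval may be open, closed or half-open. -/
def IsBox {ι : Type*} (B : Set (ι → ℝ)) : Prop :=
  ∃ I : ι → Set ℝ, (∀ i, (I i).OrdConnected ∧ Bornology.IsBounded (I i)) ∧ B = Set.univ.pi I

/-- A finite collection of non-overlapping boxes: boxes whose interiors are pairwise disjoint. -/
def NonOverlappingBoxes {ι : Type*} {k : ℕ} (B : Fin k → Set (ι → ℝ)) : Prop :=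
  (∀ i, IsBox (B i)) ∧ ∀ i j, i ≠ j → Disjoint (interior (B i)) (interior (B j))

/-- For every `ε > 0` the set `R` contains a finite union of non-overlapping boxes, and is contained
in another one, with an error of area less than `ε` in both cases. -/
def BoxApproximable {ι : Type*} [Fintype ι] (R : Set (ι → ℝ)) : Prop :=
  ∀ ε : ℝ, 0 < ε →
    ∃ (k : ℕ) (B : Fin k → Set (ι → ℝ)) (l : ℕ) (C : Fin l → Set (ι → ℝ)),
      NonOverlappingBoxes B ∧ NonOverlappingBoxes C ∧
      (⋃ i, B i) ⊆ R ∧ R ⊆ (⋃ j, C j) ∧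
      volume (R \ ⋃ i, B i) < ENNReal.ofReal ε ∧
      volume ((⋃ j, C j) \ R) < ENNReal.ofReal ε

/-- The map `g_p` from `GL_n(ℤ/pℤ)` to the cube of dimension `2n²`. A point of the cube is an
`n × 2n` array: row `i` holds `a_{i1}/p, …, a_{in}/p` and then `b_{i1}/p, …, b_{in}/p`, where
`a_{ij}` and `b_{ij}` are the representatives in `{0, …, p - 1}` of the entries of `A` and of the
inverse of `A`. -/
noncomputable def invPoint (n p : ℕ) (A : GL (Fin n) (ZMod p)) :
    Fin n × (Fin n ⊕ Fin n) → ℝ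
  | (i, Sum.inl j) => (((A : Matrix (Fin n) (Fin n) (ZMod p)) i j).val : ℝ) / (p : ℝ)
  | (i, Sum.inr j) =>
      ((((A⁻¹ : GL (Fin n) (ZMod p)) : Matrix (Fin n) (Fin n) (ZMod p)) i j).val : ℝ) / (p : ℝ)

/-! By Weyl's criterion on the torus of dimension $2n^2$, equidistribution reduces to cancellation,
for each fixed nonzero frequency, in a sum of $\psi(L(A)+M(A^{-1}))$ over $\mathrm{GL}_n(\mathbb
F_p)$. Here $L$ and $M$ are linear functionals, not both zero once $p$ is large. Replacing $A$ by
$tA$ and averaging over scalars $t$ turns the summand into a classical Kloosterman sum with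
parameters $L(A)$, $M(A^{-1})$ (`card_units_mul_matrixKloostermanSum`). That sum is $O(q^{3/4})$ by
Kloosterman's elementary fourth-moment argument, unless both parameters vanish, which happens for a
proportion at most $2^n/q$ of the matrices. This gives `norm_matrixKloostermanSum_div_le`.

Box approximability enters only through `BoxApproximable.volume_frontier`: the frontier of $R$ is
null, so weak convergence of the empirical measures on the torus yields convergence of the counts
(`tendsto_card_div_of_tendsto_mFourier`). -/

/-! ### Classical Kloosterman sums and the fourth-moment bound. -/

section Kloosterman

variable {F : Type*} [Field F] [Fintype F] [DecidableEq F]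

/-- The Kloosterman sum of an additive character. -/
noncomputable def kloostermanSum (ψ : AddChar F ℂ) (a b : F) : ℂ :=
  ∑ t : Fˣ, ψ (a * t + b * (t⁻¹ : Fˣ))

lemma kloostermanSum_twist (ψ : AddChar F ℂ) (a b : F) (s : Fˣ) :
    kloostermanSum ψ (a * s) (b * (s⁻¹ : Fˣ)) = kloostermanSum ψ a b := by
  unfold kloostermanSum
  refine Fintype.sum_equiv (Equiv.mulLeft s) _ _ fun t => ?_
  simp only [Equiv.coe_mulLeft, mul_inv, Units.val_mul]
  ring_nf

lemma kloostermanSum_sq (ψ : AddChar F ℂ) (a b : F) :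
    kloostermanSum ψ a b ^ 2 = ∑ z : Fˣ × Fˣ,
      ψ (a * (z.1 + z.2) + b * ((z.1⁻¹ : Fˣ) + (z.2⁻¹ : Fˣ))) := by
  rw [sq, kloostermanSum, Finset.sum_mul_sum, Fintype.sum_prod_type]
  refine Finset.sum_congr rfl fun x _ => Finset.sum_congr rfl fun y _ => ?_
  rw [← AddChar.map_add_eq_mul]
  ring_nf

/-- Pairs of pairs of units with equal sums and equal sums of inverses. -/
def equalSumPairs (F : Type*) [Field F] [Fintype F] [DecidableEq F] :
    Finset ((Fˣ × Fˣ) × (Fˣ × Fˣ)) :=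
  {v | (v.1.1 : F) + v.1.2 = v.2.1 + v.2.2 ∧
    ((v.1.1⁻¹ : Fˣ) : F) + (v.1.2⁻¹ : Fˣ) = (v.2.1⁻¹ : Fˣ) + (v.2.2⁻¹ : Fˣ)}

/-- If the common sum is nonzero, equal sums of inverses force equal products, so both pairs are the
roots of one quadratic and agree up to order. If it is zero, each pair is $(x,-x)$. This leaves
three families, each parametrized by two units. -/
lemma card_equalSumPairs_le : (equalSumPairs F).card ≤ 3 * Fintype.card Fˣ ^ 2 := by
  have hsub : equalSumPairs F ⊆
      ((Finset.univ : Finset (Fˣ × Fˣ)).image (fun z => (z, z)) ∪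
        (Finset.univ : Finset (Fˣ × Fˣ)).image (fun z => (z, z.swap))) ∪
        (Finset.univ : Finset (Fˣ × Fˣ)).image (fun z => ((z.1, -z.1), (z.2, -z.2))) := by
    rintro ⟨⟨x, y⟩, ⟨z, w⟩⟩ h
    simp only [equalSumPairs, Finset.mem_filter, Finset.mem_univ, true_and] at h
    obtain ⟨h1, h2⟩ := h
    simp only [Finset.mem_union, Finset.mem_image, Finset.mem_univ, true_and, Prod.exists,
      Prod.mk.injEq, Prod.swap_prod_mk]
    have hx := x.ne_zero
    have hy := y.ne_zero
    have hz := z.ne_zero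
    have hw := w.ne_zero
    simp only [Units.val_inv_eq_inv_val] at h2
    field_simp at h2
    by_cases hs : (x : F) + y = 0
    · right
      refine ⟨x, z, ⟨rfl, ?_⟩, rfl, ?_⟩ <;> ext <;> push_cast
      · linear_combination -hs
      · linear_combination h1 - hs
    · left
      have h3 : (x : F) * y = z * w := by
        apply mul_left_cancel₀ hs
        linear_combination -h2 + (x:F) * y * h1
      have h4 : ((x : F) - z) * (x - w) = 0 := by
        linear_combination (x : F) * h1 - h3
      rcases mul_eq_zero.mp h4 with h | h
      · left
        refine ⟨x, y, ⟨rfl, rfl⟩, ?_, ?_⟩ <;> ext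
        · linear_combination h
        · linear_combination h1 - h
      · right
        refine ⟨x, y, ⟨rfl, rfl⟩, ?_, ?_⟩ <;> ext
        · linear_combination h1 - h
        · linear_combination h
  refine (Finset.card_le_card hsub).trans ((Finset.card_union_le _ _).trans ?_)
  refine (add_le_add_left (Finset.card_union_le _ _) _).trans ?_
  have hc : (Finset.univ : Finset (Fˣ × Fˣ)).card = Fintype.card Fˣ ^ 2 := by
    rw [Finset.card_univ, Fintype.card_prod, sq]
  have h1 := (Finset.card_image_le (s := (Finset.univ : Finset (Fˣ × Fˣ)))
    (f := fun z => (z, z))).trans_eq hc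
  have h2 := (Finset.card_image_le (s := (Finset.univ : Finset (Fˣ × Fˣ)))
    (f := fun z => (z, z.swap))).trans_eq hc
  have h3 := (Finset.card_image_le (s := (Finset.univ : Finset (Fˣ × Fˣ)))
    (f := fun z => ((z.1, -z.1), (z.2, -z.2)))).trans_eq hc
  omega

/-- Expanding the fourth power, orthogonality in each of the two parameters leaves exactly the
solutions of the two equations. -/
lemma sum_norm_kloostermanSum_pow_four {ψ : AddChar F ℂ} (hψ : ψ.IsPrimitive) :
    ∑ z : F × F, ‖kloostermanSum ψ z.1 z.2‖ ^ 4 =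
      (Fintype.card F : ℝ) ^ 2 * (equalSumPairs F).card := by
  have key : ∀ a b : F, ((‖kloostermanSum ψ a b‖ ^ 4 : ℝ) : ℂ) =
      ∑ v : (Fˣ × Fˣ) × (Fˣ × Fˣ),
        ψ (a * ((v.1.1 : F) + v.1.2 - (v.2.1 + v.2.2))) *
        ψ (b * (((v.1.1⁻¹ : Fˣ) : F) + (v.1.2⁻¹ : Fˣ) - (((v.2.1⁻¹ : Fˣ) : F) + (v.2.2⁻¹ : Fˣ)))) := by
    intro a b
    have h : ((‖kloostermanSum ψ a b‖ ^ 4 : ℝ) : ℂ) =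
        kloostermanSum ψ a b ^ 2 * (starRingEnd ℂ) (kloostermanSum ψ a b ^ 2) := by
      rw [Complex.mul_conj', norm_pow]
      push_cast
      ring
    rw [h, kloostermanSum_sq, map_sum, Finset.sum_mul_sum]
    refine Eq.trans ?_ (Fintype.sum_prod_type _).symm
    refine Finset.sum_congr rfl fun x _ => Finset.sum_congr rfl fun y _ => ?_
    rw [← AddChar.map_neg_eq_conj, ← AddChar.map_add_eq_mul, ← AddChar.map_add_eq_mul]
    ring_nf
  have hc : ((∑ z : F × F, ‖kloostermanSum ψ z.1 z.2‖ ^ 4 : ℝ) : ℂ) =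
      (((Fintype.card F : ℝ) ^ 2 * (equalSumPairs F).card : ℝ) : ℂ) := by
    rw [Complex.ofReal_sum]
    simp only [key]
    rw [Finset.sum_comm, equalSumPairs, Finset.card_filter]
    push_cast
    rw [Finset.mul_sum]
    refine Finset.sum_congr rfl fun v _ => ?_
    rw [Fintype.sum_prod_type]
    simp only
    rw [← Finset.sum_mul_sum, AddChar.sum_mulShift _ hψ, AddChar.sum_mulShift _ hψ]
    simp only [sub_eq_zero]
    split_ifs <;> simp_all [sq]
  exact_mod_cast hc

/-- The twists $(as, bs^{-1})$ are distinct for distinct units $s$ and share one Kloosterman sum, so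
the fourth moment contains this term $q-1$ times. -/
lemma norm_kloostermanSum_pow_four_le {ψ : AddChar F ℂ} (hψ : ψ.IsPrimitive) {a b : F}
    (hab : a ≠ 0 ∨ b ≠ 0) :
    (Fintype.card Fˣ : ℝ) * ‖kloostermanSum ψ a b‖ ^ 4 ≤
      3 * (Fintype.card F : ℝ) ^ 2 * (Fintype.card Fˣ : ℝ) ^ 2 := by
  have hinj : Function.Injective (fun s : Fˣ => (a * (s : F), b * ((s⁻¹ : Fˣ) : F))) := by
    intro s t h
    simp only [Prod.mk.injEq] at h
    rcases hab with ha | hb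
    · exact Units.ext (mul_left_cancel₀ ha h.1)
    · exact inv_injective (Units.ext (mul_left_cancel₀ hb h.2))
  have h1 : (Fintype.card Fˣ : ℝ) * ‖kloostermanSum ψ a b‖ ^ 4 =
      ∑ z ∈ Finset.univ.map ⟨_, hinj⟩, ‖kloostermanSum ψ z.1 z.2‖ ^ 4 := by
    simp only [Finset.sum_map, Function.Embedding.coeFn_mk, kloostermanSum_twist,
      Finset.sum_const, Finset.card_univ, nsmul_eq_mul]
  have h2 := Finset.sum_le_sum_of_subset_of_nonneg
    (Finset.subset_univ (Finset.univ.map ⟨_, hinj⟩))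
    (f := fun z : F × F => ‖kloostermanSum ψ z.1 z.2‖ ^ 4) (fun _ _ _ => by positivity)
  have h3 : ((equalSumPairs F).card : ℝ) ≤ 3 * (Fintype.card Fˣ : ℝ) ^ 2 := by
    exact_mod_cast card_equalSumPairs_le
  rw [sum_norm_kloostermanSum_pow_four hψ] at h2
  rw [h1]
  refine h2.trans ?_
  nlinarith [mul_le_mul_of_nonneg_left h3 (sq_nonneg (Fintype.card F : ℝ))]

/-- Kloosterman's bound, relative to the number of terms. -/
lemma norm_kloostermanSum_div_pow_four_le {ψ : AddChar F ℂ} (hψ : ψ.IsPrimitive) {a b : F}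
    (hab : a ≠ 0 ∨ b ≠ 0) :
    (‖kloostermanSum ψ a b‖ / Fintype.card Fˣ) ^ 4 ≤ 12 / Fintype.card Fˣ := by
  have h := norm_kloostermanSum_pow_four_le hψ hab
  have hpos : (1 : ℝ) ≤ Fintype.card Fˣ := by exact_mod_cast Fintype.card_pos
  -- Since $q \le 2(q-1)$, the factor $3q^2$ is at most $12(q-1)^2$; hence the constant 12.
  have hF : (Fintype.card F : ℝ) ≤ 2 * Fintype.card Fˣ := by
    have : Fintype.card F = Fintype.card Fˣ + 1 := by
      rw [Fintype.card_units]
      exact (Nat.sub_add_cancel Fintype.card_pos).symm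
    rw [this]
    push_cast
    linarith
  rw [div_pow, div_le_div_iff₀ (by positivity) (by positivity)]
  have h4 : (Fintype.card F : ℝ) ^ 2 ≤ 4 * (Fintype.card Fˣ : ℝ) ^ 2 := by nlinarith
  have h5 := mul_le_mul_of_nonneg_right h4 (sq_nonneg (Fintype.card Fˣ : ℝ))
  nlinarith

end Kloosterman

/-! ### Cancellation in matrix Kloosterman sums. -/

section MatrixSum

variable {F : Type*} [Field F] [Fintype F] [DecidableEq F] {n : ℕ}

/-- The matrix Kloosterman sum attached to two linear functionals on matrices. -/
noncomputable def matrixKloostermanSum (ψ : AddChar F ℂ) (L M : Matrix (Fin n) (Fin n) F →ₗ[F] F) :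
    ℂ :=
  ∑ A : GL (Fin n) F, ψ (L A.val + M (A⁻¹).val)

/-- Averaging over the scalar matrices reduces matrix Kloosterman sums to classical ones. -/
lemma card_units_mul_matrixKloostermanSum (ψ : AddChar F ℂ)
    (L M : Matrix (Fin n) (Fin n) F →ₗ[F] F) :
    (Fintype.card Fˣ : ℂ) * matrixKloostermanSum ψ L M =
      ∑ A : GL (Fin n) F, kloostermanSum ψ (L A.val) (M (A⁻¹).val) := by
  unfold kloostermanSum
  rw [Finset.sum_comm]
  have h : ∀ t : Fˣ, ∑ A : GL (Fin n) F, ψ (L A.val * t + M (A⁻¹).val * (t⁻¹ : Fˣ)) =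
      matrixKloostermanSum ψ L M := by
    intro t
    refine Fintype.sum_equiv (MulAction.toPerm t) _ _ fun A => ?_
    have hinv : (t • A)⁻¹ = t⁻¹ • A⁻¹ := rfl
    rw [MulAction.toPerm_apply, hinv, Units.val_smul, Units.val_smul, Units.smul_def,
      Units.smul_def, map_smul, map_smul, smul_eq_mul, smul_eq_mul, mul_comm, mul_comm (M _)]
  simp only [h, Finset.sum_const, Finset.card_univ, nsmul_eq_mul]

lemma card_mul_card_ker {V : Type*} [AddCommGroup V] [Module F V] [Fintype V]
    {L : V →ₗ[F] F} (hL : L ≠ 0) :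
    Fintype.card F * Nat.card (LinearMap.ker L) = Fintype.card V := by
  have h := L.ker.card_eq_card_quotient_mul_card
  have e := (L.quotKerEquivOfSurjective (LinearMap.surjective hL)).toEquiv
  rw [Nat.card_congr e] at h
  simpa [mul_comm] using h.symm

lemma card_mul_card_filter_ker_le {L : Matrix (Fin n) (Fin n) F →ₗ[F] F} (hL : L ≠ 0) :
    Fintype.card F * (Finset.univ.filter fun A : GL (Fin n) F => L A.val = 0).card ≤
      (Fintype.card F ^ n) ^ n := by
  have hV : Fintype.card (Matrix (Fin n) (Fin n) F) = (Fintype.card F ^ n) ^ n := by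
    change Fintype.card (Fin n → Fin n → F) = _
    simp
  rw [← hV, ← card_mul_card_ker hL]
  refine Nat.mul_le_mul_left _ ?_
  rw [← Fintype.card_subtype, ← Nat.card_eq_fintype_card]
  refine Nat.card_le_card_of_injective (fun A => ⟨A.1.val, A.2⟩) fun A B h => ?_
  exact Subtype.ext (Units.ext (congrArg Subtype.val h))

lemma card_filter_inv_ker (M : Matrix (Fin n) (Fin n) F →ₗ[F] F) :
    (Finset.univ.filter fun A : GL (Fin n) F => M (A⁻¹).val = 0).card =
      (Finset.univ.filter fun A : GL (Fin n) F => M A.val = 0).card :=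
  Finset.card_equiv (Equiv.inv _) (by simp)

/-- One nonzero functional suffices: its kernel is a hyperplane, and inversion permutes the group.
-/
lemma card_mul_card_filter_both_le {L M : Matrix (Fin n) (Fin n) F →ₗ[F] F} (h : L ≠ 0 ∨ M ≠ 0) :
    Fintype.card F * (Finset.univ.filter fun A : GL (Fin n) F =>
      L A.val = 0 ∧ M (A⁻¹).val = 0).card ≤ (Fintype.card F ^ n) ^ n := by
  rcases h with h | h
  · refine le_trans (Nat.mul_le_mul_left _ (Finset.card_le_card ?_)) (card_mul_card_filter_ker_le h)
    exact Finset.monotone_filter_right _ fun A _ hA => hA.1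
  · refine le_trans (Nat.mul_le_mul_left _ (Finset.card_le_card ?_))
      ((congrArg _ (card_filter_inv_ker M)).trans_le (card_mul_card_filter_ker_le h))
    exact Finset.monotone_filter_right _ fun A _ hA => hA.2

-- Each factor $q^n-q^i$ of the group order, with $i<n$, is at least $q^n/2$.
variable (F n) in
lemma pow_pow_le_card_GL : (Fintype.card F ^ n) ^ n ≤ 2 ^ n * Fintype.card (GL (Fin n) F) := by
  rw [← Nat.card_eq_fintype_card (α := GL (Fin n) F), Matrix.card_GL_field]
  have h1 : (2 : ℕ) ^ n = ∏ _i : Fin n, 2 := by simp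
  have h2 : (Fintype.card F ^ n) ^ n = ∏ _i : Fin n, Fintype.card F ^ n := by simp
  rw [h1, h2, ← Finset.prod_mul_distrib]
  refine Finset.prod_le_prod' fun i _ => ?_
  have hq : 2 ≤ Fintype.card F := Fintype.one_lt_card
  have h3 : 2 * Fintype.card F ^ (i : ℕ) ≤ Fintype.card F ^ n := by
    calc 2 * Fintype.card F ^ (i : ℕ) ≤ Fintype.card F * Fintype.card F ^ (i : ℕ) :=
          Nat.mul_le_mul_right _ hq
      _ = Fintype.card F ^ ((i : ℕ) + 1) := by rw [pow_succ, mul_comm]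
      _ ≤ _ := Nat.pow_le_pow_right (by omega) i.2
  omega

lemma norm_kloostermanSum_div_le {ψ : AddChar F ℂ} (hψ : ψ.IsPrimitive) (a b : F) :
    ‖kloostermanSum ψ a b‖ / Fintype.card Fˣ ≤
      (12 / Fintype.card Fˣ : ℝ) ^ (1 / 4 : ℝ) + if a = 0 ∧ b = 0 then 1 else 0 := by
  have hc : (0 : ℝ) < Fintype.card Fˣ := by exact_mod_cast Fintype.card_pos
  split_ifs with h
  · have h1 : ‖kloostermanSum ψ a b‖ ≤ Fintype.card Fˣ := by
      refine (norm_sum_le _ _).trans ?_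
      simp [AddChar.norm_apply]
    have h2 := div_le_one_of_le₀ h1 hc.le
    have h3 : (0 : ℝ) ≤ (12 / Fintype.card Fˣ : ℝ) ^ (1 / 4 : ℝ) := by positivity
    linarith
  · rw [add_zero, one_div, Real.le_rpow_inv_iff_of_pos (by positivity) (by positivity)
      (by norm_num)]
    have := norm_kloostermanSum_div_pow_four_le hψ (not_and_or.mp h)
    exact_mod_cast this

/-- Matrix Kloosterman sums exhibit cancellation. -/
lemma norm_matrixKloostermanSum_div_le {ψ : AddChar F ℂ} (hψ : ψ.IsPrimitive)
    {L M : Matrix (Fin n) (Fin n) F →ₗ[F] F} (h : L ≠ 0 ∨ M ≠ 0) :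
    ‖matrixKloostermanSum ψ L M‖ / Fintype.card (GL (Fin n) F) ≤
      (12 / Fintype.card Fˣ : ℝ) ^ (1 / 4 : ℝ) + 2 ^ n / Fintype.card F := by
  have hc : (0 : ℝ) < Fintype.card Fˣ := by exact_mod_cast Fintype.card_pos
  have hq : (0 : ℝ) < Fintype.card F := by exact_mod_cast Fintype.card_pos
  have hG : (0 : ℝ) < Fintype.card (GL (Fin n) F) := by exact_mod_cast Fintype.card_pos
  set β := (12 / Fintype.card Fˣ : ℝ) ^ (1 / 4 : ℝ)
  set Z := Finset.univ.filter fun A : GL (Fin n) F => L A.val = 0 ∧ M (A⁻¹).val = 0 with hZ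
  have h1 : ‖matrixKloostermanSum ψ L M‖ ≤ Fintype.card (GL (Fin n) F) * β + Z.card := by
    have e : matrixKloostermanSum ψ L M = (∑ A : GL (Fin n) F,
        kloostermanSum ψ (L A.val) (M (A⁻¹).val)) / (Fintype.card Fˣ : ℂ) := by
      rw [← card_units_mul_matrixKloostermanSum, mul_div_cancel_left₀]
      exact_mod_cast hc.ne'
    rw [e, Finset.sum_div]
    refine (norm_sum_le _ _).trans ?_
    have : ∀ A : GL (Fin n) F,
        ‖kloostermanSum ψ (L A.val) (M (A⁻¹).val) / (Fintype.card Fˣ : ℂ)‖ ≤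
        β + if L A.val = 0 ∧ M (A⁻¹).val = 0 then 1 else 0 := by
      intro A
      rw [norm_div, Complex.norm_natCast]
      exact norm_kloostermanSum_div_le hψ _ _
    refine (Finset.sum_le_sum fun A _ => this A).trans_eq ?_
    rw [Finset.sum_add_distrib, Finset.sum_const, Finset.card_univ, nsmul_eq_mul, hZ,
      Finset.sum_boole]
  have h2 : (Fintype.card F : ℝ) * Z.card ≤ 2 ^ n * Fintype.card (GL (Fin n) F) := by
    exact_mod_cast (card_mul_card_filter_both_le h).trans (pow_pow_le_card_GL F n)
  have h3 : (Z.card : ℝ) ≤ 2 ^ n / Fintype.card F * Fintype.card (GL (Fin n) F) := by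
    rw [div_mul_eq_mul_div, le_div_iff₀ hq]
    linarith
  rw [div_le_iff₀ hG]
  linarith

end MatrixSum

/-! ### Box-approximable sets have null frontier. -/

section JordanMeasurable

variable {ι : Type*}

lemma IsBox.convex {B : Set (ι → ℝ)} (hB : IsBox B) : Convex ℝ B := by
  obtain ⟨I, hI, rfl⟩ := hB
  exact convex_pi fun i _ => (hI i).1.convex

variable [Fintype ι]

lemma volume_closure_iUnion_diff_of_isBox {k : ℕ} {B : Fin k → Set (ι → ℝ)}
    (hB : ∀ i, IsBox (B i)) : volume (closure (⋃ i, B i) \ ⋃ i, B i) = 0 := by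
  refine measure_mono_null (t := ⋃ i, frontier (B i)) ?_
    (measure_iUnion_null fun i => (hB i).convex.addHaar_frontier volume)
  rintro x ⟨hx, hx'⟩
  rw [closure_iUnion_of_finite, Set.mem_iUnion] at hx
  obtain ⟨i, hi⟩ := hx
  exact Set.mem_iUnion.mpr
    ⟨i, hi, fun h => hx' (Set.mem_iUnion.mpr ⟨i, interior_subset h⟩)⟩

lemma volume_iUnion_diff_interior_of_isBox {k : ℕ} {B : Fin k → Set (ι → ℝ)}
    (hB : ∀ i, IsBox (B i)) : volume ((⋃ i, B i) \ interior (⋃ i, B i)) = 0 := by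
  refine measure_mono_null (t := ⋃ i, frontier (B i)) ?_
    (measure_iUnion_null fun i => (hB i).convex.addHaar_frontier volume)
  rintro x ⟨hx, hx'⟩
  obtain ⟨i, hi⟩ := Set.mem_iUnion.mp hx
  exact Set.mem_iUnion.mpr
    ⟨i, subset_closure hi, fun h => hx' (interior_mono (Set.subset_iUnion B i) h)⟩

/-- A frontier point lies in the closure of the outer union and outside the interior of the inner
one. So it lies in one of the two approximation gaps or on a box boundary, which is null by
convexity. -/
lemma BoxApproximable.volume_frontier {R : Set (ι → ℝ)} (hR : BoxApproximable R) :
    volume (frontier R) = 0 := by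
  refine le_antisymm (ENNReal.le_of_forall_pos_le_add fun ε hε _ => ?_) zero_le
  obtain ⟨k, B, l, C, hB, hC, hBR, hRC, hBε, hCε⟩ := hR (ε / 2) (by positivity)
  have hsub : frontier R ⊆ ((closure (⋃ j, C j) \ ⋃ j, C j) ∪
      ((⋃ i, B i) \ interior (⋃ i, B i))) ∪ ((R \ ⋃ i, B i) ∪ ((⋃ j, C j) \ R)) := by
    rintro x ⟨hx, hx'⟩
    have h1 := closure_mono hRC hx
    have h2 : x ∉ interior (⋃ i, B i) := fun h => hx' (interior_mono hBR h)
    by_cases hxC : x ∈ ⋃ j, C j <;> by_cases hxB : x ∈ ⋃ i, B i <;> by_cases hxR : x ∈ R <;>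
      simp_all only [Set.mem_union, Set.mem_sdiff, not_true_eq_false, not_false_eq_true, and_true,
        true_and, and_self, or_true, true_or]
  calc volume (frontier R) ≤ _ := measure_mono hsub
    _ ≤ _ := measure_union_le _ _
    _ ≤ (0 + 0) + (ENNReal.ofReal (ε / 2) + ENNReal.ofReal (ε / 2)) := by
      refine add_le_add ((measure_union_le _ _).trans (add_le_add ?_ ?_))
        ((measure_union_le _ _).trans (add_le_add hBε.le hCε.le))
      · exact (volume_closure_iUnion_diff_of_isBox hC.1).le
      · exact (volume_iUnion_diff_interior_of_isBox hB.1).le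
    _ = 0 + ε := by
      rw [← ENNReal.ofReal_add (by positivity) (by positivity)]
      simp

end JordanMeasurable

/-! ### Weyl's criterion and passage from the cube to the torus. -/

section Torus

variable {ι : Type*} [Fintype ι]

/-- The covering map of the torus. -/
def torusMk (x : ι → ℝ) : UnitAddTorus ι := fun i => (x i : UnitAddCircle)

omit [Fintype ι] in
lemma isOpenMap_torusMk : IsOpenMap (torusMk : (ι → ℝ) → UnitAddTorus ι) :=
  IsOpenMap.piMap (f := fun (_ : ι) (x : ℝ) => (x : UnitAddCircle))
    (fun _ => QuotientAddGroup.isOpenMap_coe)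
    (Eventually.of_forall fun _ => QuotientAddGroup.mk_surjective)

omit [Fintype ι] in
lemma continuous_torusMk : Continuous (torusMk : (ι → ℝ) → UnitAddTorus ι) :=
  Continuous.piMap fun _ => AddCircle.continuous_mk' 1

omit [Fintype ι] in
lemma torusMk_injOn_Ico :
    Set.InjOn torusMk (Set.univ.pi fun _ : ι => Set.Ico (0 : ℝ) 1) := by
  intro x hx y hy h
  ext i
  have hxi := hx i (Set.mem_univ i)
  have hyi := hy i (Set.mem_univ i)
  refine (AddCircle.coe_eq_coe_iff_of_mem_Ico (p := (1 : ℝ)) (a := 0) ?_ ?_).mp (congrFun h i)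
  · simpa using hxi
  · simpa using hyi

/-- The uniform probability measure on the torus. -/
noncomputable def torusMeasure (ι : Type*) [Fintype ι] : Measure (UnitAddTorus ι) :=
  (volume.restrict (Set.univ.pi fun _ : ι => Set.Ico (0 : ℝ) 1)).map torusMk

instance : IsProbabilityMeasure (torusMeasure ι) := by
  have : IsProbabilityMeasure
      (volume.restrict (Set.univ.pi fun _ : ι => Set.Ico (0 : ℝ) 1)) :=
    ⟨by simp [Real.volume_pi_Ico]⟩
  exact Measure.isProbabilityMeasure_map continuous_torusMk.aemeasurable

lemma torusMeasure_image {W : Set (ι → ℝ)} (hW : IsOpen W)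
    (hsub : W ⊆ Set.univ.pi fun _ => Set.Ico 0 1) : torusMeasure ι (torusMk '' W) = volume W := by
  rw [torusMeasure, Measure.map_apply continuous_torusMk.measurable
    (isOpenMap_torusMk _ hW).measurableSet, Measure.restrict_apply
    (continuous_torusMk.measurable (isOpenMap_torusMk _ hW).measurableSet)]
  congr 1
  ext x
  constructor
  · rintro ⟨⟨y, hy, hxy⟩, hx⟩
    rwa [← torusMk_injOn_Ico (hsub hy) hx hxy]
  · exact fun hx => ⟨⟨x, hx, rfl⟩, hsub hx⟩

lemma integral_fourier_Ico {n : ℤ} (hn : n ≠ 0) :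
    ∫ x in Set.Ico (0 : ℝ) 1, fourier n (x : UnitAddCircle) = 0 := by
  rw [integral_Ico_eq_integral_Ioc, ← intervalIntegral.integral_of_le zero_le_one]
  have h : ∀ x : ℝ, fourier n (x : UnitAddCircle) =
      Complex.exp ((2 * Real.pi * Complex.I * n) * x) := by
    intro x
    rw [fourier_coe_apply]
    simp
  have hc : (2 * Real.pi * Complex.I * n : ℂ) ≠ 0 := by
    simp [hn, Real.pi_ne_zero]
  simp only [h]
  rw [integral_exp_mul_complex hc]
  have : Complex.exp (2 * Real.pi * Complex.I * n * (1 : ℝ)) = 1 :=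
    Complex.exp_eq_one_iff.mpr ⟨n, by push_cast; ring⟩
  rw [this]
  simp

lemma integral_mFourier_torusMeasure {k : ι → ℤ} (hk : k ≠ 0) :
    ∫ x, UnitAddTorus.mFourier k x ∂(torusMeasure ι) = 0 := by
  rw [torusMeasure, integral_map continuous_torusMk.aemeasurable
    (UnitAddTorus.mFourier k).continuous.aestronglyMeasurable, volume_pi,
    Measure.restrict_pi_pi]
  change ∫ x : ι → ℝ, ∏ i, fourier (k i) (x i : UnitAddCircle) ∂_ = 0
  rw [integral_fintype_prod_eq_prod (f := fun i (x : ℝ) => fourier (k i) (x : UnitAddCircle))]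
  obtain ⟨i, hi⟩ := Function.ne_iff.mp hk
  exact Finset.prod_eq_zero (Finset.mem_univ i) (integral_fourier_Ico hi)

/-- The uniform probability measure on a finite family of points. -/
noncomputable def empiricalMeasure {α X : Type*} [Fintype α] [MeasurableSpace X] (x : α → X) :
    Measure X :=
  (Fintype.card α : ENNReal)⁻¹ • ∑ a, Measure.dirac (x a)

instance {α X : Type*} [Fintype α] [Nonempty α] [MeasurableSpace X] (x : α → X) :
    IsProbabilityMeasure (empiricalMeasure x) := ⟨by
  simp [empiricalMeasure, ENNReal.inv_mul_cancel]⟩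

lemma integral_empiricalMeasure {α X : Type*} [Fintype α] [TopologicalSpace X] [CompactSpace X]
    [MeasurableSpace X] [OpensMeasurableSpace X] [MeasurableSingletonClass X]
    (x : α → X) (f : C(X, ℂ)) :
    ∫ y, f y ∂(empiricalMeasure x) = (∑ a, f (x a)) / Fintype.card α := by
  rw [empiricalMeasure, integral_smul_measure, integral_finsetSum_measure]
  · simp [integral_dirac, div_eq_inv_mul]
  · intro a _
    exact integrable_dirac (by simp)

/-- The Weyl criterion on a torus. -/
lemma tendsto_integral_of_tendsto_mFourier {κ : Type*} {l : Filter κ}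
    {μ : κ → Measure (UnitAddTorus ι)} [∀ i, IsProbabilityMeasure (μ i)]
    (h : ∀ k : ι → ℤ, k ≠ 0 → Tendsto (fun i => ∫ x, UnitAddTorus.mFourier k x ∂(μ i)) l (𝓝 0))
    (f : C(UnitAddTorus ι, ℂ)) :
    Tendsto (fun i => ∫ x, f x ∂(μ i)) l (𝓝 (∫ x, f x ∂(torusMeasure ι))) := by
  have hint : ∀ (ν : Measure (UnitAddTorus ι)) [IsProbabilityMeasure ν]
      (g : C(UnitAddTorus ι, ℂ)), Integrable g ν := fun ν _ g =>
    g.continuous.integrable_of_hasCompactSupport (HasCompactSupport.of_compactSpace g)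
  have hdist : ∀ (ν : Measure (UnitAddTorus ι)) [IsProbabilityMeasure ν]
      (g g' : C(UnitAddTorus ι, ℂ)), dist (∫ x, g x ∂ν) (∫ x, g' x ∂ν) ≤ dist g g' := by
    intro ν _ g g'
    rw [dist_eq_norm, ← integral_sub (hint ν g) (hint ν g')]
    refine (norm_integral_le_of_norm_le_const (C := dist g g') (ae_of_all _ fun x => ?_)).trans ?_
    · rw [← dist_eq_norm]
      exact ContinuousMap.dist_apply_le_dist x
    · simp
  have hspan : ∀ g ∈ Submodule.span ℂ (Set.range (UnitAddTorus.mFourier (d := ι))),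
      Tendsto (fun i => ∫ x, g x ∂(μ i)) l (𝓝 (∫ x, g x ∂(torusMeasure ι))) := by
    intro g hg
    induction hg using Submodule.span_induction with
    | mem g hg =>
      obtain ⟨k, rfl⟩ := hg
      by_cases hk : k = 0
      · subst hk
        simpa [UnitAddTorus.mFourier_zero] using tendsto_const_nhds
      · rw [integral_mFourier_torusMeasure hk]
        exact h k hk
    | zero => simpa using tendsto_const_nhds
    | add g g' _ _ hg hg' =>
      simp only [ContinuousMap.add_apply]
      rw [integral_add (hint _ g) (hint _ g')]
      simp only [integral_add (hint (μ _) g) (hint (μ _) g')]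
      exact hg.add hg'
    | smul c g _ hg =>
      simp only [ContinuousMap.smul_apply, integral_smul]
      exact hg.const_smul c
  rw [Metric.tendsto_nhds]
  intro ε hε
  -- Trigonometric polynomials are uniformly dense, and integration against a probability measure is
  -- 1-Lipschitz in the sup norm.
  have hf : f ∈ closure (Submodule.span ℂ (Set.range (UnitAddTorus.mFourier (d := ι))) :
      Set C(UnitAddTorus ι, ℂ)) := by
    have := UnitAddTorus.span_mFourier_closure_eq_top (d := ι)
    rw [← Submodule.topologicalClosure_coe, this]
    trivial
  obtain ⟨g, hg, hfg⟩ := Metric.mem_closure_iff.mp hf (ε / 3) (by positivity)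
  filter_upwards [Metric.tendsto_nhds.mp (hspan g hg) (ε / 3) (by positivity)] with i hi
  have h1 := hdist (μ i) f g
  have h2 := hdist (torusMeasure ι) g f
  rw [dist_comm g f] at h2
  have h3 := dist_triangle4 (∫ x, f x ∂(μ i)) (∫ x, g x ∂(μ i)) (∫ x, g x ∂(torusMeasure ι))
    (∫ x, f x ∂(torusMeasure ι))
  linarith

/-- The torus glues opposite faces of the cube, so frontiers need not correspond. However, the
interior of $R$ and the open part of the cube off its closure have disjoint open images of total
measure 1. The complement of these images is null and contains the frontier of the image of $R$. -/
lemma torusMeasure_image_of_null_frontier {R : Set (ι → ℝ)}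
    (hR : R ⊆ Set.Icc 0 1) (hfr : volume (frontier R) = 0) :
    torusMeasure ι (torusMk '' (R ∩ Set.univ.pi fun _ => Set.Ico 0 1)) = volume R ∧
    torusMeasure ι (frontier (torusMk '' (R ∩ Set.univ.pi fun _ => Set.Ico 0 1))) = 0 := by
  set Q : Set (ι → ℝ) := Set.univ.pi fun _ => Set.Ico 0 1 with hQ
  set E := torusMk '' (R ∩ Q) with hE
  have hintQ : interior (Set.Icc 0 1 : Set (ι → ℝ)) ⊆ Q := by
    rw [← Set.pi_univ_Icc, interior_pi_set Set.finite_univ]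
    exact Set.pi_mono fun i _ => by simpa using Set.Ioo_subset_Ico_self
  set U := interior R
  set V := interior (Set.Icc 0 1 : Set (ι → ℝ)) \ closure R
  have hU : U ⊆ Q := (interior_mono hR).trans hintQ
  have hV : V ⊆ Q := Set.sdiff_subset.trans hintQ
  have hUo : IsOpen U := isOpen_interior
  have hVo : IsOpen V := isOpen_interior.sdiff isClosed_closure
  have hRi : volume R ≤ volume U := by
    calc volume R ≤ volume (U ∪ frontier R) := measure_mono (by
          intro x hx
          by_cases h : x ∈ U
          · exact Or.inl h
          · exact Or.inr ⟨subset_closure hx, h⟩)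
      _ ≤ volume U + volume (frontier R) := measure_union_le _ _
      _ = volume U := by rw [hfr, add_zero]
  have hcl : volume (closure R) ≤ volume R := by
    calc volume (closure R) = volume (R ∪ frontier R) := by rw [closure_eq_self_union_frontier]
      _ ≤ volume R + volume (frontier R) := measure_union_le _ _
      _ = volume R := by rw [hfr, add_zero]
  have hcube : volume (interior (Set.Icc 0 1 : Set (ι → ℝ))) = 1 := by
    rw [← Set.pi_univ_Icc, interior_pi_set Set.finite_univ]
    simp [Real.volume_pi_Ioo]
  have hUV : 1 ≤ volume U + volume V := by
    calc 1 = volume (interior (Set.Icc 0 1 : Set (ι → ℝ))) := hcube.symm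
      _ ≤ volume (closure R ∪ V) := measure_mono (by
          intro x hx
          by_cases h : x ∈ closure R
          · exact Or.inl h
          · exact Or.inr ⟨hx, h⟩)
      _ ≤ volume (closure R) + volume V := measure_union_le _ _
      _ ≤ volume U + volume V := add_le_add_left (hcl.trans hRi) _
  have hUE : torusMk '' U ⊆ E := Set.image_mono (Set.subset_inter interior_subset hU)
  have hVE : Disjoint (torusMk '' V) E := by
    rw [Set.disjoint_left]
    rintro _ ⟨y, hy, rfl⟩ ⟨x, hx, hxy⟩
    rw [torusMk_injOn_Ico hx.2 (hV hy) hxy] at hx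
    exact hy.2 (subset_closure hx.1)
  have hmU := torusMeasure_image hUo hU
  have hmV := torusMeasure_image hVo hV
  have hmeasU := (isOpenMap_torusMk _ hUo).measurableSet
  have hmeasV := (isOpenMap_torusMk _ hVo).measurableSet
  have hdisj : Disjoint (torusMk '' U) (torusMk '' V) := (hVE.mono_right hUE).symm
  have hnull : torusMeasure ι (torusMk '' U ∪ torusMk '' V)ᶜ = 0 := by
    rw [prob_compl_eq_zero_iff (hmeasU.union hmeasV)]
    refine le_antisymm prob_le_one ?_
    rw [measure_union hdisj hmeasV, hmU, hmV]
    exact hUV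
  constructor
  · refine le_antisymm ?_ ?_
    · calc torusMeasure ι E ≤ torusMeasure ι (torusMk '' U ∪ (torusMk '' U ∪ torusMk '' V)ᶜ) :=
            measure_mono (by
              intro z hz
              by_cases h : z ∈ torusMk '' U
              · exact Or.inl h
              · exact Or.inr fun h' => h'.elim h fun h' => Set.disjoint_left.mp hVE h' hz)
        _ ≤ _ := measure_union_le _ _
        _ = volume U := by rw [hnull, add_zero, hmU]
        _ ≤ volume R := measure_mono interior_subset
    · exact hRi.trans (hmU.symm.trans_le (measure_mono hUE))
  · refine measure_mono_null ?_ hnull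
    rintro z ⟨hz, hz'⟩ (h | h)
    · exact hz' (interior_maximal hUE (isOpenMap_torusMk _ hUo) h)
    · exact Set.disjoint_left.mp (hVE.closure_right (isOpenMap_torusMk _ hVo)) h hz

/-- Families of points of the unit cube with decaying exponential sums are equidistributed with
respect to Jordan measurable sets. -/
theorem tendsto_card_div_of_tendsto_mFourier {κ : Type*} {l : Filter κ} {α : κ → Type*}
    [∀ i, Fintype (α i)] [∀ i, Nonempty (α i)] (x : ∀ i, α i → ι → ℝ)
    (hx : ∀ i a, x i a ∈ Set.univ.pi fun _ => Set.Ico (0 : ℝ) 1)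
    (h : ∀ k : ι → ℤ, k ≠ 0 → Tendsto (fun i =>
      (∑ a, UnitAddTorus.mFourier k (torusMk (x i a))) / Fintype.card (α i)) l (𝓝 0))
    {R : Set (ι → ℝ)} (hR : R ⊆ Set.Icc 0 1) (hfr : volume (frontier R) = 0) :
    Tendsto (fun i => ((x i ⁻¹' R).ncard : ℝ) / Fintype.card (α i)) l (𝓝 (volume R).toReal) := by
  classical
  let μ : κ → ProbabilityMeasure (UnitAddTorus ι) := fun i =>
    ⟨empiricalMeasure fun a => torusMk (x i a), inferInstance⟩
  let ν : ProbabilityMeasure (UnitAddTorus ι) := ⟨torusMeasure ι, inferInstance⟩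
  have hlim : Tendsto μ l (𝓝 ν) := by
    rw [ProbabilityMeasure.tendsto_iff_forall_integral_rclike_tendsto ℂ]
    intro f
    refine tendsto_integral_of_tendsto_mFourier
      (μ := fun i => empiricalMeasure fun a => torusMk (x i a)) ?_ f.toContinuousMap
    intro k hk
    simp only [integral_empiricalMeasure]
    exact h k hk
  obtain ⟨hE, hEfr⟩ := torusMeasure_image_of_null_frontier hR hfr
  set Q : Set (ι → ℝ) := Set.univ.pi fun _ => Set.Ico 0 1 with hQ
  have key := ProbabilityMeasure.tendsto_measure_of_null_frontier_of_tendsto' hlim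
    (E := torusMk '' (R ∩ Q)) hEfr
  have hE' : (ν : Measure (UnitAddTorus ι)) (torusMk '' (R ∩ Q)) = volume R := hE
  rw [hE'] at key
  have hfin : volume R ≠ ⊤ := by
    rw [← hE']
    exact measure_ne_top _ _
  refine ((ENNReal.tendsto_toReal hfin).comp key).congr fun i => ?_
  have hmem : ∀ a, torusMk (x i a) ∈ torusMk '' (R ∩ Q) ↔ x i a ∈ R := by
    intro a
    constructor
    · rintro ⟨y, hy, hxy⟩
      rw [torusMk_injOn_Ico hy.2 (hx i a) hxy] at hy
      exact hy.1
    · exact fun ha => ⟨x i a, ⟨ha, hx i a⟩, rfl⟩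
  change (empiricalMeasure (fun a => torusMk (x i a)) (torusMk '' (R ∩ Q))).toReal = _
  have hcard : (x i ⁻¹' R).ncard = (Finset.univ.filter fun a => x i a ∈ R).card := by
    rw [← Set.ncard_coe_finset]
    congr 1
    ext a
    simp
  rw [hcard, empiricalMeasure]
  simp only [Measure.smul_apply, Measure.finsetSum_apply, Measure.dirac_apply, Set.indicator_apply,
    hmem, Pi.one_apply, Finset.sum_boole, smul_eq_mul, ENNReal.toReal_mul, ENNReal.toReal_inv,
    ENNReal.toReal_natCast]
  rw [div_eq_inv_mul]

end Torus

/-! ### Exponential sums over the points $g_p(A)$. -/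

section InversePoints

variable {n : ℕ}

/-- The linear functional on matrices with given weights on the entries. -/
def entryWeightedSum {F : Type*} [Field F] (c : Fin n → Fin n → F) :
    Matrix (Fin n) (Fin n) F →ₗ[F] F :=
  ∑ i, ∑ j, c i j • Matrix.entryLinearMap F F i j

lemma entryWeightedSum_apply {F : Type*} [Field F] (c : Fin n → Fin n → F)
    (A : Matrix (Fin n) (Fin n) F) : entryWeightedSum c A = ∑ i, ∑ j, c i j * A i j := by
  simp [entryWeightedSum]

lemma entryWeightedSum_ne_zero {F : Type*} [Field F] {c : Fin n → Fin n → F} {i j : Fin n}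
    (h : c i j ≠ 0) : entryWeightedSum c ≠ 0 := by
  intro h0
  have h1 := LinearMap.congr_fun h0 (Matrix.single i j 1)
  rw [entryWeightedSum_apply, Finset.sum_eq_single i, Finset.sum_eq_single j] at h1
  · simp [h] at h1
  · intro b _ hb
    simp [hb.symm]
  · simp
  · intro b _ hb
    simp [hb.symm]
  · simp

lemma fourier_val_div {p : ℕ} [NeZero p] (k : ℤ) (a : ZMod p) :
    fourier k (((a.val : ℝ) / p : ℝ) : UnitAddCircle) = ZMod.stdAddChar ((k : ZMod p) * a) := by
  have h : ((k : ZMod p) * a) = ((k * a.val : ℤ) : ZMod p) := by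
    push_cast
    rw [ZMod.natCast_zmod_val]
  rw [h, ZMod.stdAddChar_coe, fourier_coe_apply]
  congr 1
  push_cast
  ring

lemma AddChar.map_finset_sum {A M ι : Type*} [AddCommMonoid A] [CommMonoid M] (ψ : AddChar A M)
    (s : Finset ι) (f : ι → A) : ψ (∑ i ∈ s, f i) = ∏ i ∈ s, ψ (f i) :=
  map_prod ψ.toMonoidHom (fun i => Multiplicative.ofAdd (f i)) s

lemma mFourier_invPoint {p : ℕ} [Fact p.Prime] (k : Fin n × (Fin n ⊕ Fin n) → ℤ)
    (A : GL (Fin n) (ZMod p)) :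
    UnitAddTorus.mFourier k (torusMk (invPoint n p A)) =
      ZMod.stdAddChar
        (entryWeightedSum (fun i j => (k (i, Sum.inl j) : ZMod p)) A.val +
          entryWeightedSum (fun i j => (k (i, Sum.inr j) : ZMod p)) (A⁻¹).val) := by
  rw [AddChar.map_add_eq_mul, entryWeightedSum_apply, entryWeightedSum_apply]
  simp only [AddChar.map_finset_sum]
  change ∏ z, fourier (k z) ((invPoint n p A z : ℝ) : UnitAddCircle) = _
  rw [Fintype.prod_prod_type, ← Finset.prod_mul_distrib]
  refine Finset.prod_congr rfl fun i _ => ?_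
  rw [Fintype.prod_sum_type]
  simp only [invPoint, fourier_val_div]

lemma invPoint_mem_Ico {p : ℕ} [Fact p.Prime] (A : GL (Fin n) (ZMod p)) :
    invPoint n p A ∈ Set.univ.pi fun _ => Set.Ico (0 : ℝ) 1 := by
  have hp : (0 : ℝ) < p := by exact_mod_cast (Fact.out : p.Prime).pos
  have h : ∀ a : ZMod p, (a.val : ℝ) / p ∈ Set.Ico (0 : ℝ) 1 := fun a =>
    ⟨by positivity, (div_lt_one hp).mpr (by exact_mod_cast ZMod.val_lt a)⟩
  rintro ⟨i, j | j⟩ _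
  · exact h _
  · exact h _

lemma invPoint_injective {p : ℕ} [Fact p.Prime] : Function.Injective (invPoint n p) := by
  intro A B h
  have hp : (p : ℝ) ≠ 0 := by exact_mod_cast (Fact.out : p.Prime).ne_zero
  ext i j
  have h1 := congrFun h (i, Sum.inl j)
  simp only [invPoint] at h1
  rw [div_left_inj' hp, Nat.cast_inj] at h1
  exact ZMod.val_injective p h1

lemma tendsto_sum_mFourier_invPoint {k : Fin n × (Fin n ⊕ Fin n) → ℤ} (hk : k ≠ 0) :
    Tendsto (fun p : Nat.Primes => haveI := Fact.mk p.2
      (∑ A : GL (Fin n) (ZMod p), UnitAddTorus.mFourier k (torusMk (invPoint n p A))) /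
        Fintype.card (GL (Fin n) (ZMod p)))
      (comap (fun p : Nat.Primes => (p : ℕ)) atTop) (𝓝 0) := by
  obtain ⟨⟨i, s⟩, hz⟩ := Function.ne_iff.mp hk
  have hlim : Tendsto (fun p : ℕ => (12 / (p - 1 : ℝ)) ^ (1 / 4 : ℝ) + 2 ^ n / (p : ℝ)) atTop
      (𝓝 0) := by
    have h1 : Tendsto (fun p : ℕ => (12 / (p - 1 : ℝ))) atTop (𝓝 0) :=
      tendsto_const_nhds.div_atTop
        (tendsto_atTop_add_const_right _ _ tendsto_natCast_atTop_atTop)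
    have h2 := h1.rpow_const (p := (1 / 4 : ℝ)) (Or.inr (by norm_num))
    have h3 : Tendsto (fun p : ℕ => (2 ^ n / (p : ℝ))) atTop (𝓝 0) :=
      tendsto_const_nhds.div_atTop tendsto_natCast_atTop_atTop
    rw [Real.zero_rpow (by norm_num)] at h2
    simpa using h2.add h3
  refine squeeze_zero_norm' ?_ (hlim.comp tendsto_comap)
  -- A prime larger than a nonzero coordinate of $k$ in absolute value cannot divide it, so the
  -- functional carrying that coordinate is nonzero mod $p$.
  filter_upwards [tendsto_comap.eventually (eventually_gt_atTop (k (i, s)).natAbs)] with p hp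
  have := Fact.mk p.2
  have hne : (k (i, s) : ZMod p) ≠ 0 := by
    rw [Ne, ZMod.intCast_zmod_eq_zero_iff_dvd]
    intro hd
    have := Nat.le_of_dvd (Int.natAbs_pos.mpr hz) (Int.natCast_dvd.mp hd)
    omega
  have hLM : entryWeightedSum (fun i j => (k (i, Sum.inl j) : ZMod p)) ≠ 0 ∨
      entryWeightedSum (fun i j => (k (i, Sum.inr j) : ZMod p)) ≠ 0 := by
    rcases s with j | j
    · exact Or.inl (entryWeightedSum_ne_zero (i := i) (j := j) hne)
    · exact Or.inr (entryWeightedSum_ne_zero (i := i) (j := j) hne)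
  have h := norm_matrixKloostermanSum_div_le (ZMod.isPrimitive_stdAddChar p) hLM
  rw [ZMod.card_units, ZMod.card, Nat.cast_sub p.2.one_le, Nat.cast_one] at h
  rw [norm_div, Complex.norm_natCast]
  simp only [mFourier_invPoint]
  exact h

end InversePoints

theorem theorem2 (n : ℕ) (R : Set (Fin n × (Fin n ⊕ Fin n) → ℝ))
    (hR : R ⊆ Set.Icc 0 1) (hmeas : NullMeasurableSet R volume) (happrox : BoxApproximable R) :
    Tendsto
      (fun p : ℕ =>
        ((Set.range (invPoint n p) ∩ R).ncard : ℝ) / (Nat.card (GL (Fin n) (ZMod p)) : ℝ))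
      (atTop ⊓ 𝓟 {p : ℕ | p.Prime})
      (𝓝 (volume R).toReal) := by
  -- Moving to the subtype of primes makes primality available at every index, not just eventually.
  have hfilter : (atTop ⊓ 𝓟 {p : ℕ | p.Prime} : Filter ℕ) =
      map (fun p : Nat.Primes => (p : ℕ)) (comap (fun p : Nat.Primes => (p : ℕ)) atTop) := by
    rw [Filter.map_comap]
    congr 2
    exact Subtype.range_coe.symm
  rw [hfilter, tendsto_map'_iff]
  have : ∀ p : Nat.Primes, Fact (p : ℕ).Prime := fun p => ⟨p.2⟩
  refine (tendsto_card_div_of_tendsto_mFourier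
    (fun (p : Nat.Primes) (A : GL (Fin n) (ZMod p)) => invPoint n p A)
    (fun p A => invPoint_mem_Ico A) (fun k hk => tendsto_sum_mFourier_invPoint hk) hR
    happrox.volume_frontier).congr fun p => ?_
  -- Injectivity of $g_p$ identifies counting image points in $R$ with counting matrices.
  rw [Function.comp_apply, ← Set.ncard_image_of_injective _ invPoint_injective,
    Set.image_preimage_eq_range_inter, Nat.card_eq_fintype_card]
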